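/- An accessible pointed graph (APG) is a directed graph with a distinguished node (the root) from which every node is reachable by a directed path; the children of a node are the targets of its outgoing edges. Two APGs are bisimilar if there is a relation $R$ between their nodes that relates the roots and is such that, whenever $x\mathrel R y$, every child of $x$ is $R$-related to some child of $y$ and every child of $y$ has some child of $x$ $R$-related to it. The class $V$ of non-well-founded sets consists of the APGs modulo bisimilarity. For an APG $s$ write $u\in s$ if $u$ is the APG of all nodes reachable from some child $x$ of the root of $s$, with root $x$; write $s=\emptyset$ if the root of $s$ has no children. Let $B$ be the Banach space of bounded functions $g:\mathrm{APG}^2\to\mathbb R$ with the supremum norm, and let $\tau:B\to B$ be $$\tau(g)(s,t)=\begin{cases}0 & \text{if } s=t=\emptyset,\\ 1 & \text{if exactly one of } s,t \text{ is } \emptyset,\\ \tfrac12\max\bigl\{\sup_{u\in s}\inf_{v\in t}g(u,v),\ \sup_{v\in t}\inf_{u\in s}g(u,v)\bigr\} & \text{if } s,t\ne\emptyset.\end{cases}$$ The map $\tau$ is a contraction with constant $1/2$; let $d$ be its unique fixed point. It is invariant under bisimilarity, hence well defined as a function $d:V^2\to\mathbb R$. Write $s\approx t$ if $d(s,t)=0$.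 Call $s\in V$ singular if $\{t\in V: s\approx t\}=\{s\}$, and hereditarily finite if $s$ is represented by some APG in which every node has finite out-degree (not necessarily bounded). Theorem. A set $s\in V$ is singular if and only if it is hereditarily finite. -/

import Mathlib

open Relation
open scoped ENNReal

universe u

namespace NWF

/-- An accessible pointed graph: a directed graph with a distinguished node from which every node
is reachable by a directed path. `Edge x y` is read "`y` is an element (child) of `x`". -/
structure APG : Type (u + 1) where
  Node : Type u
  Edge : Node → Node → Prop
  root : Node
  reachable : ∀ x, ReflTransGen Edge root x

/-- A bisimulation between the nodes of two graphs. -/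
def IsBisimulation (G H : APG.{u}) (R : G.Node → H.Node → Prop) : Prop :=
  ∀ x y, R x y →
    (∀ x', G.Edge x x' → ∃ y', H.Edge y y' ∧ R x' y') ∧
    (∀ y', H.Edge y y' → ∃ x', G.Edge x x' ∧ R x' y')

/-- Two accessible pointed graphs are bisimilar if some bisimulation relates their roots. -/
def Bisimilar (G H : APG.{u}) : Prop :=
  ∃ R : G.Node → H.Node → Prop, IsBisimulation G H R ∧ R G.root H.root

theorem Bisimilar.refl (G : APG.{u}) : Bisimilar G G :=
  ⟨Eq, fun _ _ h => by subst h; exact ⟨fun z hz => ⟨z, hz, rfl⟩, fun z hz => ⟨z, hz, rfl⟩⟩, rfl⟩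

theorem Bisimilar.symm {G H : APG.{u}} : Bisimilar G H → Bisimilar H G := by
  rintro ⟨R, hR, h⟩
  exact ⟨fun y x => R x y, fun y x hxy => ⟨(hR x y hxy).2, (hR x y hxy).1⟩, h⟩

theorem Bisimilar.trans {G H K : APG.{u}} : Bisimilar G H → Bisimilar H K → Bisimilar G K := by
  rintro ⟨R, hR, h⟩ ⟨S, hS, k⟩
  refine ⟨fun x z => ∃ y, R x y ∧ S y z, ?_, ⟨_, h, k⟩⟩
  rintro x z ⟨y, hxy, hyz⟩
  constructor
  · intro x' hx'
    obtain ⟨y', hy', hr⟩ := (hR x y hxy).1 x' hx'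
    obtain ⟨z', hz', hs⟩ := (hS y z hyz).1 y' hy'
    exact ⟨z', hz', y', hr, hs⟩
  · intro z' hz'
    obtain ⟨y', hy', hs⟩ := (hS y z hyz).2 z' hz'
    obtain ⟨x', hx', hr⟩ := (hR x y hxy).2 y' hy'
    exact ⟨x', hx', y', hr, hs⟩

instance APG.setoid : Setoid APG.{u} where
  r := Bisimilar
  iseqv := ⟨Bisimilar.refl, Bisimilar.symm, Bisimilar.trans⟩

/-- The non-well-founded sets: accessible pointed graphs up to bisimilarity. -/
def V : Type (u + 1) := Quotient APG.setoid.{u}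

/-- The set represented by an accessible pointed graph. -/
def APG.toV (G : APG.{u}) : V.{u} := Quotient.mk _ G

/-- The accessible pointed graph of all nodes reachable from `x`, pointed at `x`; it represents
the set that `G` assigns to the node `x`. -/
def APG.sub (G : APG.{u}) (x : G.Node) : APG.{u} where
  Node := {y : G.Node // ReflTransGen G.Edge x y}
  Edge a b := G.Edge a.1 b.1
  root := ⟨x, ReflTransGen.refl⟩
  reachable := by
    rintro ⟨y, hy⟩
    induction hy with
    | refl => exact ReflTransGen.refl
    | tail h e ih => exact ReflTransGen.tail ih e

/-- The children of the root of `G`. -/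
abbrev APG.Child (G : APG.{u}) : Type u := {x : G.Node // G.Edge G.root x}

/-- The element of `G` (again an accessible pointed graph) given by a child of the root. -/
def APG.elem (G : APG.{u}) (x : G.Child) : APG.{u} := G.sub x.1

open Classical in
/-- The coinductive Hausdorff operator `τ` on functions of two accessible pointed graphs; the
supremum and the infimum over `u ∈ s` range over the elements `s.elem x` of `s`. -/
noncomputable def tauFun (g : APG.{u} → APG.{u} → ℝ) (s t : APG.{u}) : ℝ :=
  if IsEmpty s.Child ∧ IsEmpty t.Child then 0
  else if IsEmpty s.Child ∨ IsEmpty t.Child then 1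
  else (1 / 2) * max (⨆ x : s.Child, ⨅ y : t.Child, g (s.elem x) (t.elem y))
                     (⨆ y : t.Child, ⨅ x : s.Child, g (s.elem x) (t.elem y))

theorem supinf_le {ι κ ι' κ' : Type u} [Nonempty ι] [Nonempty κ']
    {f : ι → κ → ℝ} {f' : ι' → κ' → ℝ} {c C : ℝ}
    (hf : ∀ i j, |f i j| ≤ C) (hf' : ∀ i j, |f' i j| ≤ C)
    (h : ∀ i, ∃ i', ∀ j', ∃ j, f i j ≤ f' i' j' + c) :
    (⨆ i, ⨅ j, f i j) ≤ (⨆ i, ⨅ j, f' i j) + c := by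
  have bb : ∀ i, BddBelow (Set.range (f i)) := fun i =>
    ⟨-C, by rintro _ ⟨j, rfl⟩; exact (abs_le.1 (hf i j)).1⟩
  have bb' : ∀ i, BddBelow (Set.range (f' i)) := fun i =>
    ⟨-C, by rintro _ ⟨j, rfl⟩; exact (abs_le.1 (hf' i j)).1⟩
  have ba' : BddAbove (Set.range fun i => ⨅ j, f' i j) := by
    refine ⟨C, ?_⟩
    rintro _ ⟨i, rfl⟩
    exact (ciInf_le (bb' i) (Classical.arbitrary κ')).trans (abs_le.1 (hf' i _)).2
  refine ciSup_le fun i => ?_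
  obtain ⟨i', hi'⟩ := h i
  have h1 : (⨅ j, f i j) - c ≤ ⨅ j, f' i' j := by
    refine le_ciInf fun j' => ?_
    obtain ⟨j, hj⟩ := hi' j'
    have := ciInf_le (bb i) j
    linarith
  have h2 := le_ciSup ba' i'
  linarith

theorem tauFun_le {g g' : APG.{u} → APG.{u} → ℝ} {c C : ℝ} (hc : 0 ≤ c)
    (hg : ∀ s t, |g s t| ≤ C) (hg' : ∀ s t, |g' s t| ≤ C) {s t s' t' : APG.{u}}
    (R S : APG.{u} → APG.{u} → Prop)
    (hs : ∀ x : s.Child, ∃ x' : s'.Child, R (s.elem x) (s'.elem x'))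
    (hs' : ∀ x' : s'.Child, ∃ x : s.Child, R (s.elem x) (s'.elem x'))
    (ht : ∀ x : t.Child, ∃ x' : t'.Child, S (t.elem x) (t'.elem x'))
    (ht' : ∀ x' : t'.Child, ∃ x : t.Child, S (t.elem x) (t'.elem x'))
    (h : ∀ u u' v v', R u u' → S v v' → g u v ≤ g' u' v' + c) :
    tauFun g s t ≤ tauFun g' s' t' + c / 2 := by
  have es : IsEmpty s.Child ↔ IsEmpty s'.Child :=
    ⟨fun e => ⟨fun x => (hs' x).elim fun y _ => e.false y⟩,
      fun e => ⟨fun x => (hs x).elim fun y _ => e.false y⟩⟩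
  have et : IsEmpty t.Child ↔ IsEmpty t'.Child :=
    ⟨fun e => ⟨fun x => (ht' x).elim fun y _ => e.false y⟩,
      fun e => ⟨fun x => (ht x).elim fun y _ => e.false y⟩⟩
  unfold tauFun
  rw [es, et]
  split_ifs with h1 h2
  · linarith
  · linarith
  · push Not at h2
    obtain ⟨h2, h3⟩ := h2
    have h4 : Nonempty s.Child := by
      rw [← not_isEmpty_iff, es]; exact not_isEmpty_iff.2 h2
    have h5 : Nonempty t.Child := by
      rw [← not_isEmpty_iff, et]; exact not_isEmpty_iff.2 h3
    have i1 := supinf_le (f := fun (x : s.Child) (y : t.Child) => g (s.elem x) (t.elem y))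
      (f' := fun (x : s'.Child) (y : t'.Child) => g' (s'.elem x) (t'.elem y)) (c := c)
      (fun _ _ => hg _ _) (fun _ _ => hg' _ _) (fun x => by
        obtain ⟨x', hx⟩ := hs x
        refine ⟨x', fun y' => ?_⟩
        obtain ⟨y, hy⟩ := ht' y'
        exact ⟨y, h _ _ _ _ hx hy⟩)
    have i2 := supinf_le (f := fun (y : t.Child) (x : s.Child) => g (s.elem x) (t.elem y))
      (f' := fun (y : t'.Child) (x : s'.Child) => g' (s'.elem x) (t'.elem y)) (c := c)
      (fun _ _ => hg _ _) (fun _ _ => hg' _ _) (fun y => by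
        obtain ⟨y', hy⟩ := ht y
        refine ⟨y', fun x' => ?_⟩
        obtain ⟨x, hx⟩ := hs' x'
        exact ⟨x, h _ _ _ _ hx hy⟩)
    have i3 := max_le_max i1 i2
    rw [max_add_add_right] at i3
    linarith

theorem tauFun_bdd {g : APG.{u} → APG.{u} → ℝ} {C : ℝ} (hg : ∀ s t, |g s t| ≤ C)
    (s t : APG.{u}) : |tauFun g s t| ≤ 1 + C / 2 := by
  have hC : 0 ≤ C := (abs_nonneg _).trans (hg s t)
  have h0 : ∀ s t : APG.{u}, |(0 : APG.{u} → APG.{u} → ℝ) s t| ≤ C := by intro s t; simpa using hC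
  have a : |tauFun (0 : APG.{u} → APG.{u} → ℝ) s t| ≤ 1 := by
    unfold tauFun
    split_ifs with h1 h2
    · simp
    · simp
    · simp
  have h1 := tauFun_le hC hg h0 (s := s) (t := t) Eq Eq (fun x => ⟨x, rfl⟩) (fun x => ⟨x, rfl⟩)
    (fun x => ⟨x, rfl⟩) (fun x => ⟨x, rfl⟩)
    (by rintro p _ q _ rfl rfl; have := abs_le.1 (hg p q); simp; linarith)
  have h2 := tauFun_le hC h0 hg (s := s) (t := t) Eq Eq (fun x => ⟨x, rfl⟩) (fun x => ⟨x, rfl⟩)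
    (fun x => ⟨x, rfl⟩) (fun x => ⟨x, rfl⟩)
    (by rintro p _ q _ rfl rfl; have := abs_le.1 (hg p q); simp; linarith)
  rw [abs_le] at a ⊢
  constructor <;> linarith

/-- The Banach space of bounded real-valued functions of two accessible pointed graphs, with the
supremum norm. -/
abbrev B : Type (u + 1) := lp (fun _ : APG.{u} × APG.{u} => ℝ) ∞

theorem B.apply_le (g : B.{u}) (s t : APG.{u}) : |g (s, t)| ≤ ‖g‖ := by
  simpa using lp.norm_apply_le_norm ENNReal.top_ne_zero g (s, t)

instance : Nonempty B.{u} := ⟨0⟩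

/-- The operator `τ` on the Banach space `B`. -/
noncomputable def tau (g : B.{u}) : B.{u} :=
  ⟨fun p => tauFun (fun s t => g (s, t)) p.1 p.2, by
    apply memℓp_infty
    refine ⟨1 + ‖g‖ / 2, ?_⟩
    rintro _ ⟨p, rfl⟩
    exact tauFun_bdd (B.apply_le g) p.1 p.2⟩

theorem tau_apply (g : B.{u}) (s t : APG.{u}) :
    tau g (s, t) = tauFun (fun s t => g (s, t)) s t := rfl

theorem tau_contracting : ContractingWith (1 / 2) tau.{u} := by
  refine ⟨by rw [← NNReal.coe_lt_coe]; norm_num, LipschitzWith.of_dist_le_mul fun g g' => ?_⟩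
  rw [dist_eq_norm, dist_eq_norm]
  refine lp.norm_le_of_forall_le (by positivity) fun p => ?_
  have key : ∀ a b : B.{u}, tau a p ≤ tau b p + ‖a - b‖ / 2 := fun a b =>
    tauFun_le (C := max ‖a‖ ‖b‖) (norm_nonneg _)
      (fun s t => (B.apply_le a s t).trans (le_max_left _ _))
      (fun s t => (B.apply_le b s t).trans (le_max_right _ _)) Eq Eq
      (fun x => ⟨x, rfl⟩) (fun x => ⟨x, rfl⟩) (fun x => ⟨x, rfl⟩) (fun x => ⟨x, rfl⟩)
      (by
        rintro s _ t _ rfl rfl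
        have := (abs_le.1 (B.apply_le (a - b) s t)).2
        rw [lp.coeFn_sub, Pi.sub_apply] at this
        linarith)
  have h1 := key g g'
  have h2 := key g' g
  rw [norm_sub_rev] at h2
  rw [lp.coeFn_sub, Pi.sub_apply, Real.norm_eq_abs, abs_le]
  push_cast
  constructor <;> linarith

/-- The unique fixed point of the contraction `τ`, as an element of `B`. -/
noncomputable def distB : B.{u} := ContractingWith.fixedPoint tau tau_contracting

theorem distB_fixed (s t : APG.{u}) :
    distB (s, t) = tauFun (fun s t => distB (s, t)) s t := by
  have h : tau distB.{u} = distB := tau_contracting.{u}.fixedPoint_isFixedPt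
  rw [← tau_apply, h]

theorem Bisimilar.elem {G H : APG.{u}} (h : Bisimilar G H) (x : G.Child) :
    ∃ y : H.Child, Bisimilar (G.elem x) (H.elem y) := by
  obtain ⟨R, hR, h⟩ := h
  obtain ⟨y, hy, hxy⟩ := (hR _ _ h).1 x.1 x.2
  refine ⟨⟨y, hy⟩, fun a b => R a.1 b.1, ?_, hxy⟩
  rintro ⟨a, ha⟩ ⟨b, hb⟩ hab
  constructor
  · rintro ⟨a', ha'⟩ e
    obtain ⟨b', e', hr⟩ := (hR a b hab).1 a' e
    exact ⟨⟨b', hb.tail e'⟩, e', hr⟩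
  · rintro ⟨b', hb'⟩ e
    obtain ⟨a', e', hr⟩ := (hR a b hab).2 b' e
    exact ⟨⟨a', ha.tail e'⟩, e', hr⟩

theorem distB_le (n : ℕ) : ∀ s t s' t' : APG.{u}, Bisimilar s s' → Bisimilar t t' →
    distB (s, t) ≤ distB (s', t') + (2 * ‖distB.{u}‖) / 2 ^ n := by
  induction n with
  | zero =>
    intro s t s' t' _ _
    have h1 := abs_le.1 (B.apply_le distB s t)
    have h2 := abs_le.1 (B.apply_le distB s' t')
    simp only [pow_zero, div_one]
    linarith
  | succ n ih =>
    intro s t s' t' hs ht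
    rw [distB_fixed s t, distB_fixed s' t', pow_succ, ← div_div]
    refine tauFun_le (by positivity) (B.apply_le distB) (B.apply_le distB) Bisimilar Bisimilar
      hs.elem ?_ ht.elem ?_ (fun a a' b b' ha hb => ih a b a' b' ha hb)
    · exact fun x => (hs.symm.elem x).imp fun _ => Bisimilar.symm
    · exact fun x => (ht.symm.elem x).imp fun _ => Bisimilar.symm

theorem distB_invariant (s t s' t' : APG.{u}) (hs : Bisimilar s s') (ht : Bisimilar t t') :
    distB (s, t) = distB (s', t') := by
  have key : ∀ s t s' t' : APG.{u}, Bisimilar s s' → Bisimilar t t' →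
      distB (s, t) ≤ distB (s', t') := by
    intro s t s' t' hs ht
    have lim : Filter.Tendsto (fun n : ℕ => distB (s', t') + (2 * ‖distB.{u}‖) / 2 ^ n)
        Filter.atTop (nhds (distB (s', t') + 0)) :=
      tendsto_const_nhds.add (tendsto_const_nhds.div_atTop
        (tendsto_pow_atTop_atTop_of_one_lt one_lt_two))
    rw [add_zero] at lim
    exact ge_of_tendsto' lim fun n => distB_le n s t s' t' hs ht
  exact le_antisymm (key _ _ _ _ hs ht) (key _ _ _ _ hs.symm ht.symm)

/-- The coinductive Hausdorff distance on non-well-founded sets. -/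
noncomputable def d : V.{u} → V.{u} → ℝ :=
  Quotient.lift₂ (fun s t => distB (s, t)) distB_invariant

/-- `s ≈ t`: the two sets have distance zero. -/
def Approx (s t : V.{u}) : Prop := d s t = 0

/-- A set is singular if its class under `Approx` is a singleton. -/
def Singular (s : V.{u}) : Prop := {t : V.{u} | Approx s t} = {s}

/-- A set is hereditarily finite if it is represented by some accessible pointed graph in which
every node has finite out-degree. -/
def HereditarilyFinite (s : V.{u}) : Prop :=
  ∃ G : APG.{u}, G.toV = s ∧ ∀ x : G.Node, {y : G.Node | G.Edge x y}.Finite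

end NWF

/-!
The distance `d` only sees finite approximations. Let `V.approx n s` be the set `s` cut off at
depth `n`, an element of the finite type `Level n` obtained by iterating the powerset `n` times.
Unfolding the fixed point equation `n` times gives `d s t = 0` if and only if `s` and `t` have the
same approximations of every depth (`approx_iff_indist`); call such sets indistinguishable.

*Hereditarily finite sets are singular.* If `a` and `b` are indistinguishable and `a` has finitely
many members, then each member of `b` agrees with members of `a` to every depth, so by the
pigeonhole principle it is indistinguishable from a single one; conversely, a member of `a` is
separated at some finite depth from all members of `a` that it is distinguishable from, so it is
indistinguishable from a member of `b`. Hence indistinguishability from hereditarily finite sets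
is a bisimulation, and bisimulations on `V` are contained in equality
(`V.eq_of_bisimulation`).

*Singular sets are hereditarily finite.* Adding a limit point to the members of `s`, or removing a
member that is a limit of other members, gives a set indistinguishable from `s`. So if `s` is
singular, its members form a closed discrete set. As `V` is compact (`exists_limit`: an ultraproduct
of the graphs representing a sequence of sets represents its limit along the ultrafilter), the
members are finite in number; and they are singular again. Choosing one node for each set occurring
in a graph of `s` then gives a graph of finite out-degree.
-/

namespace NWF

/-! ### Decorations of graphs -/

section Decoration

variable {α β : Type u}

/-- The set that the directed graph with edge relation `E` assigns to its node `x`: the class of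
the accessible pointed graph of all nodes reachable from `x`. -/
def decoration (E : α → α → Prop) (x : α) : V.{u} :=
  APG.toV
    { Node := {y : α // ReflTransGen E x y}
      Edge := fun a b => E a.1 b.1
      root := ⟨x, ReflTransGen.refl⟩
      reachable := by
        rintro ⟨y, hy⟩
        induction hy with
        | refl => exact ReflTransGen.refl
        | tail h e ih => exact ReflTransGen.tail ih e }

theorem decoration_eq_of_bisimulation {E : α → α → Prop} {E' : β → β → Prop}
    (R : α → β → Prop)
    (hR : ∀ x y, R x y → (∀ x', E x x' → ∃ y', E' y y' ∧ R x' y') ∧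
      (∀ y', E' y y' → ∃ x', E x x' ∧ R x' y'))
    {x : α} {y : β} (h : R x y) : decoration E x = decoration E' y := by
  refine Quotient.sound ⟨fun a b => R a.1 b.1, ?_, h⟩
  rintro ⟨a, ha⟩ ⟨b, hb⟩ hab
  constructor
  · rintro ⟨a', ha'⟩ e
    obtain ⟨b', e', hr⟩ := (hR a b hab).1 a' e
    exact ⟨⟨b', hb.tail e'⟩, e', hr⟩
  · rintro ⟨b', hb'⟩ e
    obtain ⟨a', e', hr⟩ := (hR a b hab).2 b' e
    exact ⟨⟨a', ha.tail e'⟩, e', hr⟩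

theorem APG.toV_eq_decoration (G : APG.{u}) : G.toV = decoration G.Edge G.root := by
  refine Quotient.sound ⟨fun a b => a = b.1, ?_, rfl⟩
  rintro _ ⟨b, hb⟩ rfl
  exact ⟨fun b' e => ⟨⟨b', hb.tail e⟩, e, rfl⟩, fun b' e => ⟨b'.1, e, rfl⟩⟩

theorem V.exists_toV (s : V.{u}) : ∃ G : APG.{u}, G.toV = s := Quotient.exists_rep s

theorem V.exists_decoration (s : V.{u}) : ∃ G : APG.{u}, s = decoration G.Edge G.root := by
  obtain ⟨G, rfl⟩ := s.exists_toV
  exact ⟨G, G.toV_eq_decoration⟩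

end Decoration

/-! ### Members, extensionality and comprehension -/

/-- The members of a non-well-founded set. -/
def V.members : V.{u} → Set V.{u} :=
  Quotient.lift (fun G : APG.{u} => Set.range fun x : G.Child => (G.elem x).toV) (by
    have key : ∀ G H : APG.{u}, Bisimilar G H →
        (Set.range fun x : G.Child => (G.elem x).toV) ⊆
          Set.range fun x : H.Child => (H.elem x).toV := by
      rintro G H h _ ⟨x, rfl⟩
      obtain ⟨y, hy⟩ := h.elem x
      exact ⟨y, Quotient.sound hy.symm⟩
    exact fun G H h => (key G H h).antisymm (key H G (Bisimilar.symm h)))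

theorem V.members_toV (G : APG.{u}) :
    G.toV.members = Set.range fun x : G.Child => (G.elem x).toV := rfl

theorem V.members_decoration {α : Type u} (E : α → α → Prop) (x : α) :
    (decoration E x).members = decoration E '' {y | E x y} := by
  -- The pointed graph at a node, restricted twice, is bisimilar to the one restricted once.
  have key : ∀ y : {y : α // ReflTransGen E x y},
      decoration (fun a b : {y : α // ReflTransGen E x y} => E a.1 b.1) y = decoration E y.1 := by
    intro y
    refine decoration_eq_of_bisimulation (fun a b => a.1 = b) ?_ rfl
    rintro ⟨a, ha⟩ _ rfl
    exact ⟨fun a' e => ⟨a'.1, e, rfl⟩, fun b' e => ⟨⟨b', ha.tail e⟩, e, rfl⟩⟩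
  ext v
  constructor
  · rintro ⟨⟨y, e⟩, rfl⟩
    exact ⟨y.1, e, (key y).symm⟩
  · rintro ⟨y, e, rfl⟩
    exact ⟨⟨⟨y, ReflTransGen.single e⟩, e⟩, key _⟩

/-- Strong extensionality: a bisimulation on `V` with respect to membership is contained in
equality. -/
theorem V.eq_of_bisimulation (R : V.{u} → V.{u} → Prop)
    (hR : ∀ a b, R a b → (∀ a' ∈ a.members, ∃ b' ∈ b.members, R a' b') ∧
      (∀ b' ∈ b.members, ∃ a' ∈ a.members, R a' b'))
    {s t : V.{u}} (h : R s t) : s = t := by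
  obtain ⟨G, rfl⟩ := s.exists_decoration
  obtain ⟨H, rfl⟩ := t.exists_decoration
  refine decoration_eq_of_bisimulation
    (fun x y => R (decoration G.Edge x) (decoration H.Edge y)) (fun x y hxy => ?_) h
  simpa [V.members_decoration] using hR _ _ hxy

theorem V.ext_members {s t : V.{u}} (h : s.members = t.members) : s = t :=
  V.eq_of_bisimulation (fun a b => a.members = b.members)
    (fun _ _ hab => ⟨fun a' ha => ⟨a', hab ▸ ha, rfl⟩, fun b' hb => ⟨b', hab ▸ hb, rfl⟩⟩) h

instance V.small_members (s : V.{u}) : Small.{u} s.members := by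
  obtain ⟨G, rfl⟩ := s.exists_decoration
  rw [V.members_decoration]
  infer_instance

/-- Comprehension: every small collection of sets is the collection of members of a set. -/
theorem V.exists_members_eq (T : Set V.{u}) [Small.{u} T] : ∃ t : V.{u}, t.members = T := by
  choose G hG using V.exists_decoration.{u}
  let f : Shrink.{u} T → V.{u} := fun i => ((equivShrink T).symm i).1
  -- A new root above the disjoint union of graphs that represent the elements of `T`.
  let E : Option (Σ i, (G (f i)).Node) → Option (Σ i, (G (f i)).Node) → Prop := fun a b =>
    (a = none ∧ ∃ i, b = some ⟨i, (G (f i)).root⟩) ∨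
      ∃ i x y, a = some ⟨i, x⟩ ∧ b = some ⟨i, y⟩ ∧ (G (f i)).Edge x y
  have key : ∀ i x, decoration E (some ⟨i, x⟩) = decoration (G (f i)).Edge x := by
    intro i x
    refine decoration_eq_of_bisimulation (fun a b => a = some ⟨i, b⟩) ?_ rfl
    rintro _ b rfl
    constructor
    · rintro a' (⟨h, _⟩ | ⟨j, y, z, h, rfl, e⟩)
      · cases h
      · cases h
        exact ⟨z, e, rfl⟩
    · exact fun b' e => ⟨_, Or.inr ⟨i, b, b', rfl, rfl, e⟩, rfl⟩
  refine ⟨decoration E none, ?_⟩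
  rw [V.members_decoration]
  ext v
  constructor
  · rintro ⟨a, (⟨-, i, rfl⟩ | ⟨i, x, y, h, -⟩), rfl⟩
    · rw [key, ← hG]
      exact ((equivShrink T).symm i).2
    · cases h
  · intro hv
    refine ⟨_, Or.inl ⟨rfl, equivShrink T ⟨v, hv⟩, rfl⟩, ?_⟩
    rw [key, ← hG]
    simp [f]

/-! ### Finite approximations -/

/-- The possible shapes of a set cut off at depth `n`. -/
def Level : ℕ → Type
  | 0 => Unit
  | n + 1 => Set (Level n)

instance Level.finite : ∀ n, Finite (Level n)
  | 0 => inferInstanceAs (Finite Unit)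
  | n + 1 =>
    have := Level.finite n
    inferInstanceAs (Finite (Set (Level n)))

/-- The set `s` cut off at depth `n`. -/
def V.approx : ∀ n, V.{u} → Level n
  | 0, _ => ()
  | n + 1, s => (V.approx n '' s.members : Set (Level n))

theorem V.approx_succ (n : ℕ) (s : V.{u}) :
    s.approx (n + 1) = (V.approx n '' s.members : Set (Level n)) := rfl

theorem V.approx_succ_eq_iff {n : ℕ} {s t : V.{u}} :
    s.approx (n + 1) = t.approx (n + 1) ↔
      (∀ u ∈ s.members, ∃ v ∈ t.members, u.approx n = v.approx n) ∧
      (∀ v ∈ t.members, ∃ u ∈ s.members, u.approx n = v.approx n) := by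
  change (V.approx n '' s.members : Set (Level n)) = V.approx n '' t.members ↔ _
  rw [Set.Subset.antisymm_iff, Set.image_subset_iff, Set.image_subset_iff]
  simp only [Set.subset_def, Set.mem_preimage, Set.mem_image, eq_comm]

theorem V.approx_eq_of_succ {n : ℕ} {s t : V.{u}} (h : s.approx (n + 1) = t.approx (n + 1)) :
    s.approx n = t.approx n := by
  induction n generalizing s t with
  | zero => rfl
  | succ n ih =>
    rw [V.approx_succ_eq_iff] at h ⊢
    refine ⟨fun u hu => ?_, fun v hv => ?_⟩
    · obtain ⟨v, hv, e⟩ := h.1 u hu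
      exact ⟨v, hv, ih e⟩
    · obtain ⟨u, hu, e⟩ := h.2 v hv
      exact ⟨u, hu, ih e⟩

theorem V.approx_eq_of_le {m n : ℕ} (hmn : m ≤ n) {s t : V.{u}} (h : s.approx n = t.approx n) :
    s.approx m = t.approx m := by
  induction n, hmn using Nat.le_induction with
  | base => exact h
  | succ n _ ih => exact ih (V.approx_eq_of_succ h)

/-- Two sets are indistinguishable if they have the same approximations of every depth. -/
def Indist (s t : V.{u}) : Prop := ∀ n, s.approx n = t.approx n

/-! ### Distance zero is indistinguishability -/

theorem d_toV (G H : APG.{u}) : d G.toV H.toV = tauFun (fun s t => d s.toV t.toV) G H :=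
  distB_fixed G H

theorem abs_d_le (s t : V.{u}) : |d s t| ≤ ‖distB.{u}‖ := by
  obtain ⟨G, rfl⟩ := s.exists_toV
  obtain ⟨H, rfl⟩ := t.exists_toV
  exact B.apply_le distB G H

/-- A lower bound from unfolding the fixed point equation `n` times; it tends to `0`, whence `d` is
nonnegative. -/
theorem neg_div_le_d (n : ℕ) (s t : V.{u}) : -(‖distB.{u}‖ / 2 ^ n) ≤ d s t := by
  induction n generalizing s t with
  | zero => simpa using (abs_le.1 (abs_d_le s t)).1
  | succ n ih =>
    obtain ⟨G, rfl⟩ := s.exists_toV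
    obtain ⟨H, rfl⟩ := t.exists_toV
    have h := tauFun_le (g := fun _ _ => 0) (g' := fun s t => d s.toV t.toV)
      (c := ‖distB.{u}‖ / 2 ^ n) (C := ‖distB.{u}‖) (by positivity)
      (fun _ _ => by simp) (fun _ _ => abs_d_le _ _)
      (s := G) (t := H) Eq Eq (fun x => ⟨x, rfl⟩) (fun x => ⟨x, rfl⟩)
      (fun x => ⟨x, rfl⟩) (fun x => ⟨x, rfl⟩)
      (by
        rintro p _ q _ rfl rfl
        linarith [ih p.toV q.toV])
    rw [← d_toV] at h
    have h0 : 0 ≤ tauFun (fun _ _ => 0) G H := by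
      unfold tauFun
      split_ifs <;> simp
    rw [pow_succ, ← div_div]
    linarith

theorem d_nonneg (s t : V.{u}) : 0 ≤ d s t := by
  have lim : Filter.Tendsto (fun n : ℕ => -(‖distB.{u}‖ / 2 ^ n)) Filter.atTop (nhds (-0)) :=
    (tendsto_const_nhds.div_atTop (tendsto_pow_atTop_atTop_of_one_lt one_lt_two)).neg
  rw [neg_zero] at lim
  exact le_of_tendsto' lim fun n => neg_div_le_d n s t

theorem d_le_of_approx_eq {n : ℕ} {s t : V.{u}} (h : s.approx n = t.approx n) :
    d s t ≤ ‖distB.{u}‖ / 2 ^ n := by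
  induction n generalizing s t with
  | zero => simpa using (abs_le.1 (abs_d_le s t)).2
  | succ n ih =>
    obtain ⟨G, rfl⟩ := s.exists_toV
    obtain ⟨H, rfl⟩ := t.exists_toV
    obtain ⟨h1, h2⟩ := V.approx_succ_eq_iff.1 h
    simp only [V.members_toV, Set.forall_mem_range, Set.exists_range_iff] at h1 h2
    rw [d_toV, pow_succ, ← div_div]
    unfold tauFun
    split_ifs with e1 e2
    · positivity
    · exfalso
      rcases e2 with e | e
      · exact e1 ⟨e, ⟨fun y => (h2 y).elim fun x _ => e.false x⟩⟩
      · exact e1 ⟨⟨fun x => (h1 x).elim fun y _ => e.false y⟩, e⟩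
    · simp only [not_or, not_isEmpty_iff] at e2
      obtain ⟨_, _⟩ := e2
      have i1 := supinf_le
        (f := fun (x : G.Child) (y : H.Child) => d (G.elem x).toV (H.elem y).toV)
        (f' := fun (_ : G.Child) (_ : H.Child) => (0 : ℝ)) (c := ‖distB.{u}‖ / 2 ^ n)
        (C := ‖distB.{u}‖) (fun _ _ => abs_d_le _ _) (fun _ _ => by simp)
        (fun x => ⟨x, fun _ => by
          obtain ⟨y, hy⟩ := h1 x
          exact ⟨y, by simpa using ih hy⟩⟩)
      have i2 := supinf_le
        (f := fun (y : H.Child) (x : G.Child) => d (G.elem x).toV (H.elem y).toV)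
        (f' := fun (_ : H.Child) (_ : G.Child) => (0 : ℝ)) (c := ‖distB.{u}‖ / 2 ^ n)
        (C := ‖distB.{u}‖) (fun _ _ => abs_d_le _ _) (fun _ _ => by simp)
        (fun y => ⟨y, fun _ => by
          obtain ⟨x, hx⟩ := h2 y
          exact ⟨x, by simpa using ih hx⟩⟩)
      simp only [ciSup_const, ciInf_const, zero_add] at i1 i2
      linarith [max_le i1 i2]

theorem le_d_of_approx_ne {n : ℕ} {s t : V.{u}} (h : s.approx n ≠ t.approx n) :
    1 / 2 ^ n ≤ d s t := by
  induction n generalizing s t with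
  | zero => exact absurd rfl h
  | succ n ih =>
    obtain ⟨G, rfl⟩ := s.exists_toV
    obtain ⟨H, rfl⟩ := t.exists_toV
    rw [ne_eq, V.approx_succ_eq_iff] at h
    simp only [V.members_toV, Set.forall_mem_range, Set.exists_range_iff] at h
    rw [d_toV]
    unfold tauFun
    split_ifs with e1 e2
    · exact absurd ⟨fun x => (e1.1.false x).elim, fun y => (e1.2.false y).elim⟩ h
    · rw [div_le_one (by positivity)]
      exact one_le_pow₀ one_le_two
    · simp only [not_or, not_isEmpty_iff] at e2
      obtain ⟨_, _⟩ := e2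
      have hc : |(1 : ℝ) / 2 ^ n| ≤ 1 + ‖distB.{u}‖ := by
        rw [abs_of_nonneg (by positivity)]
        have : (1 : ℝ) / 2 ^ n ≤ 1 := by
          rw [div_le_one (by positivity)]
          exact one_le_pow₀ one_le_two
        linarith [norm_nonneg distB.{u}]
      have hd : ∀ s t : V.{u}, |d s t| ≤ 1 + ‖distB.{u}‖ := fun s t =>
        (abs_d_le s t).trans (by linarith)
      rw [pow_succ', ← div_div, div_eq_mul_one_div (1 / 2 : ℝ)]
      refine mul_le_mul_of_nonneg_left ?_ (by norm_num)
      rw [not_and_or] at h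
      rcases h with h | h
      · push Not at h
        obtain ⟨x, hx⟩ := h
        have i := supinf_le (f := fun (_ : G.Child) (_ : H.Child) => (1 : ℝ) / 2 ^ n)
          (f' := fun (x : G.Child) (y : H.Child) => d (G.elem x).toV (H.elem y).toV) (c := 0)
          (fun _ _ => hc) (fun _ _ => hd _ _)
          (fun i => ⟨x, fun y => ⟨y, by simpa using ih (hx y)⟩⟩)
        simp only [ciSup_const, ciInf_const, add_zero] at i
        exact le_max_of_le_left i
      · push Not at h
        obtain ⟨y, hy⟩ := h
        have i := supinf_le (f := fun (_ : H.Child) (_ : G.Child) => (1 : ℝ) / 2 ^ n)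
          (f' := fun (y : H.Child) (x : G.Child) => d (G.elem x).toV (H.elem y).toV) (c := 0)
          (fun _ _ => hc) (fun _ _ => hd _ _)
          (fun i => ⟨y, fun x => ⟨x, by simpa using ih (hy x)⟩⟩)
        simp only [ciSup_const, ciInf_const, add_zero] at i
        exact le_max_of_le_right i

theorem approx_iff_indist {s t : V.{u}} : Approx s t ↔ Indist s t := by
  constructor
  · intro h n
    by_contra hn
    have := le_d_of_approx_ne hn
    rw [show d s t = 0 from h] at this
    exact absurd this (not_le.2 (by positivity))
  · intro h
    have lim : Filter.Tendsto (fun n : ℕ => ‖distB.{u}‖ / 2 ^ n) Filter.atTop (nhds 0) :=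
      tendsto_const_nhds.div_atTop (tendsto_pow_atTop_atTop_of_one_lt one_lt_two)
    exact le_antisymm (ge_of_tendsto' lim fun n => d_le_of_approx_eq (h n)) (d_nonneg s t)

theorem singular_iff {s : V.{u}} : Singular s ↔ ∀ t, Indist s t → t = s := by
  simp only [Singular, Set.eq_singleton_iff_unique_mem, Set.mem_ofPred_eq, approx_iff_indist]
  exact ⟨fun h => h.2, fun h => ⟨fun _ => rfl, h⟩⟩

/-! ### Hereditarily finite sets are singular -/

/-- `v` is in the closure of `F`: at every depth some element of `F` agrees with `v`. -/
def IsLimit (F : Set V.{u}) (v : V.{u}) : Prop := ∀ n, ∃ a ∈ F, a.approx n = v.approx n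

theorem IsLimit.exists_indist {F : Set V.{u}} (hF : F.Finite) {v : V.{u}} (h : IsLimit F v) :
    ∃ a ∈ F, Indist a v := by
  by_contra! hne
  simp only [Indist, not_forall] at hne
  choose! N hN using hne
  obtain ⟨M, hM⟩ := (hF.image N).bddAbove
  obtain ⟨a, ha, e⟩ := h M
  exact hN a ha (V.approx_eq_of_le (hM ⟨a, ha, rfl⟩) e)

/-- Indistinguishability from a set with finitely many members passes to members, in both
directions; no finiteness of `b` is needed. -/
theorem Indist.exists_of_finite {a b : V.{u}} (hab : Indist a b) (ha : a.members.Finite) :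
    (∀ a' ∈ a.members, ∃ b' ∈ b.members, Indist a' b') ∧
      (∀ b' ∈ b.members, ∃ a' ∈ a.members, Indist a' b') := by
  have back : ∀ b' ∈ b.members, ∃ a' ∈ a.members, Indist a' b' := fun b' hb' =>
    IsLimit.exists_indist ha fun n => (V.approx_succ_eq_iff.1 (hab (n + 1))).2 b' hb'
  refine ⟨fun a' ha' => ?_, back⟩
  by_contra! hne
  -- Otherwise `a'` would be a limit of the finitely many members distinguishable from it.
  obtain ⟨c, ⟨-, hc⟩, hca⟩ := IsLimit.exists_indist
    (F := {c ∈ a.members | ¬Indist c a'}) (v := a') (ha.subset (Set.sep_subset _ _)) (fun n => by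
      obtain ⟨b', hb', e⟩ := (V.approx_succ_eq_iff.1 (hab (n + 1))).1 a' ha'
      obtain ⟨c, hc, hcb⟩ := back b' hb'
      refine ⟨c, ⟨hc, fun hca => hne b' hb' fun m => (hca m).symm.trans (hcb m)⟩, ?_⟩
      exact (hcb n).trans e.symm)
  exact hc hca

theorem HereditarilyFinite.singular {s : V.{u}} (h : HereditarilyFinite s) : Singular s := by
  rw [singular_iff]
  obtain ⟨G, rfl, hG⟩ := h
  intro t ht
  refine (V.eq_of_bisimulation (fun a b => a ∈ Set.range (decoration G.Edge) ∧ Indist a b) ?_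
    ⟨⟨G.root, G.toV_eq_decoration.symm⟩, ht⟩).symm
  rintro _ b ⟨⟨x, rfl⟩, hab⟩
  have hmem : ∀ a ∈ (decoration G.Edge x).members, a ∈ Set.range (decoration G.Edge) := by
    rw [V.members_decoration]
    rintro _ ⟨y, -, rfl⟩
    exact ⟨y, rfl⟩
  obtain ⟨h1, h2⟩ := hab.exists_of_finite (by
    rw [V.members_decoration]
    exact (hG x).image _)
  constructor
  · intro a' ha'
    obtain ⟨b', hb', e⟩ := h1 a' ha'
    exact ⟨b', hb', hmem a' ha', e⟩
  · intro b' hb'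
    obtain ⟨a', ha', e⟩ := h2 b' hb'
    exact ⟨a', ha', hmem a' ha', e⟩

/-! ### Compactness by ultraproducts -/

section Ultraproduct

variable {α : ℕ → Type u} (U : Ultrafilter ℕ) (E : ∀ k, α k → α k → Prop)

theorem exists_eventually_eq {β : Type*} [Finite β] (f : ℕ → β) : ∃ c, ∀ᶠ k in U, f k = c := by
  have h : (⋃ c, f ⁻¹' {c}) ∈ U := by
    rw [Set.iUnion_eq_univ_iff.2 fun k => ⟨f k, rfl⟩]
    exact Filter.univ_mem
  rw [← Set.biUnion_univ, Ultrafilter.finite_biUnion_mem_iff Set.finite_univ] at h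
  obtain ⟨c, -, hc⟩ := h
  exact ⟨c, hc⟩

/-- The edge relation of the ultraproduct of a sequence of graphs. Functions that agree almost
everywhere are not identified, which makes no difference up to bisimilarity. -/
def ultraEdge (a b : ∀ k, α k) : Prop := ∀ᶠ k in U, E k (a k) (b k)

/-- Łoś's theorem for approximations. -/
theorem approx_decoration_ultraEdge {n : ℕ} {a : ∀ k, α k} {c : Level n}
    (h : ∀ᶠ k in U, (decoration (E k) (a k)).approx n = c) :
    (decoration (ultraEdge U E) a).approx n = c := by
  induction n generalizing a with
  | zero => rfl
  | succ n ih =>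
    let C : Set (Level n) := c
    have hmem : ∀ (k : ℕ) (q : Level n),
        (decoration (E k) (a k)).approx (n + 1) = c → (q ∈ C ↔
          ∃ b, E k (a k) b ∧ (decoration (E k) b).approx n = q) := by
      intro k q hk
      have hC : C = V.approx n '' (decoration (E k) (a k)).members := hk.symm
      rw [hC, V.members_decoration]
      simp
    rw [V.approx_succ, V.members_decoration]
    refine Set.ext fun q => ?_
    constructor
    · rintro ⟨_, ⟨b, hb, rfl⟩, rfl⟩
      obtain ⟨q, hq⟩ := exists_eventually_eq U fun k => (decoration (E k) (b k)).approx n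
      rw [ih hq]
      obtain ⟨k, hk, hbk, hqk⟩ := (h.and (Filter.Eventually.and hb hq)).exists
      exact (hmem k q hk).2 ⟨b k, hbk, hqk⟩
    · intro hq
      have hex : ∀ k, ∃ b, (decoration (E k) (a k)).approx (n + 1) = c →
          E k (a k) b ∧ (decoration (E k) b).approx n = q := fun k => by
        by_cases hk : (decoration (E k) (a k)).approx (n + 1) = c
        · exact ((hmem k q hk).1 hq).imp fun b hb _ => hb
        · exact ⟨a k, fun h => absurd h hk⟩
      choose b hb using hex
      exact ⟨_, ⟨b, h.mono fun k hk => (hb k hk).1, rfl⟩, ih (h.mono fun k hk => (hb k hk).2)⟩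

end Ultraproduct

/-- Compactness of `V`: every sequence converges along every ultrafilter. -/
theorem exists_limit (U : Ultrafilter ℕ) (x : ℕ → V.{u}) :
    ∃ v : V.{u}, ∀ n, ∀ᶠ k in U, (x k).approx n = v.approx n := by
  choose G hG using fun k => (x k).exists_decoration
  refine ⟨decoration (ultraEdge U fun k => (G k).Edge) fun k => (G k).root, fun n => ?_⟩
  obtain ⟨c, hc⟩ := exists_eventually_eq U fun k => (x k).approx n
  rw [approx_decoration_ultraEdge U _ (c := c) (by simpa only [← hG] using hc)]
  exact hc

/-! ### Singular sets are hereditarily finite -/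

/-- Two sets whose collections of members have the same closure are indistinguishable, so the
members of a singular set are the only small collection with their closure. -/
theorem Singular.members_eq {s : V.{u}} (hs : Singular s) {T : Set V.{u}} [Small.{u} T]
    (h1 : ∀ u ∈ s.members, IsLimit T u) (h2 : ∀ v ∈ T, IsLimit s.members v) : s.members = T := by
  obtain ⟨t, rfl⟩ := V.exists_members_eq T
  rw [singular_iff.1 hs t]
  rintro (_ | n)
  · rfl
  · refine V.approx_succ_eq_iff.2 ⟨fun u hu => ?_, fun v hv => h2 v hv n⟩
    obtain ⟨v, hv, e⟩ := h1 u hu n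
    exact ⟨v, hv, e.symm⟩

theorem IsLimit.of_mem {F : Set V.{u}} {v : V.{u}} (h : v ∈ F) : IsLimit F v :=
  fun _ => ⟨v, h, rfl⟩

theorem Singular.mem_of_isLimit {s : V.{u}} (hs : Singular s) {v : V.{u}}
    (hv : IsLimit s.members v) : v ∈ s.members := by
  have h : s.members = insert v s.members :=
    hs.members_eq (fun u hu => .of_mem (Set.mem_insert_of_mem _ hu)) (by
      rintro w (rfl | hw)
      · exact hv
      · exact .of_mem hw)
  rw [h]
  exact Set.mem_insert _ _

theorem Singular.not_isLimit_diff {s : V.{u}} (hs : Singular s) {v : V.{u}}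
    (hv : v ∈ s.members) : ¬IsLimit (s.members \ {v}) v := by
  intro h
  have : Small.{u} ↑(s.members \ {v}) := small_subset Set.sdiff_subset
  have e : s.members = s.members \ {v} := by
    refine hs.members_eq (fun u hu => ?_) fun w hw => .of_mem hw.1
    by_cases huv : u = v
    · exact huv ▸ h
    · exact .of_mem ⟨hu, huv⟩
  rw [e] at hv
  exact hv.2 rfl

theorem Singular.of_mem {s : V.{u}} (hs : Singular s) {v : V.{u}} (hv : v ∈ s.members) :
    Singular v := by
  refine singular_iff.2 fun w hvw => ?_
  have hw : w ∈ s.members := hs.mem_of_isLimit fun n => ⟨v, hv, hvw n⟩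
  by_contra hne
  exact hs.not_isLimit_diff hv fun n => ⟨w, ⟨hw, hne⟩, (hvw n).symm⟩

theorem Singular.finite_members {s : V.{u}} (hs : Singular s) : s.members.Finite := by
  by_contra hinf
  let x := Set.Infinite.natEmbedding _ hinf
  obtain ⟨v, hv⟩ := exists_limit (Filter.hyperfilter ℕ) fun k => (x k : V.{u})
  have hmem : v ∈ s.members := hs.mem_of_isLimit fun n =>
    (hv n).exists.imp' (fun k => (x k : V.{u})) fun k hk => ⟨(x k).2, hk⟩
  refine hs.not_isLimit_diff hmem fun n => ?_
  -- The embedding `x` takes the value `v` at most once, hence not almost everywhere.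
  have hne : ∀ᶠ k in (Filter.hyperfilter ℕ : Filter ℕ), (x k : V.{u}) ≠ v := by
    refine Filter.mem_hyperfilter_of_finite_compl (Set.Subsingleton.finite ?_)
    intro i hi j hj
    simp only [ne_eq, Set.mem_compl_iff, Set.mem_ofPred_eq, not_not] at hi hj
    exact x.injective (Subtype.ext (hi.trans hj.symm))
  obtain ⟨k, hk, hkv⟩ := ((hv n).and hne).exists
  exact ⟨x k, ⟨(x k).2, hkv⟩, hk⟩

theorem Singular.hereditarilyFinite {s : V.{u}} (hs : Singular s) : HereditarilyFinite s := by
  obtain ⟨G, rfl⟩ := s.exists_toV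
  have hsing : ∀ x, Singular (decoration G.Edge x) := fun x => by
    induction G.reachable x with
    | refl => rwa [← G.toV_eq_decoration]
    | tail _ e ih =>
      refine ih.of_mem ?_
      rw [V.members_decoration]
      exact ⟨_, e, rfl⟩
  -- Redirect every edge to a node chosen among those that represent the same set.
  have : Nonempty G.Node := ⟨G.root⟩
  let rep : V.{u} → G.Node := Function.invFun (decoration G.Edge)
  have hrep : ∀ x, decoration G.Edge (rep (decoration G.Edge x)) = decoration G.Edge x :=
    fun x => Function.invFun_eq ⟨x, rfl⟩
  let E : G.Node → G.Node → Prop := fun x y => y ∈ rep '' (decoration G.Edge x).members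
  have hE : decoration E G.root = decoration G.Edge G.root := by
    refine decoration_eq_of_bisimulation
      (fun x y => decoration G.Edge x = decoration G.Edge y) (fun x y hxy => ?_) rfl
    have hmem := V.members_decoration G.Edge y
    constructor
    · rintro _ ⟨v, hv, rfl⟩
      rw [hxy, hmem] at hv
      obtain ⟨z, hz, rfl⟩ := hv
      exact ⟨z, hz, hrep z⟩
    · intro z hz
      refine ⟨_, ⟨decoration G.Edge z, ?_, rfl⟩, hrep z⟩
      rw [hxy, hmem]
      exact ⟨z, hz, rfl⟩
  rw [G.toV_eq_decoration, ← hE]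
  exact ⟨_, rfl, fun x => (((hsing x.1).finite_members.image rep).preimage
    Subtype.val_injective.injOn)⟩

end NWF

theorem mainTheorem2 (s : NWF.V.{u}) : NWF.Singular s ↔ NWF.HereditarilyFinite s :=
  ⟨NWF.Singular.hereditarilyFinite, NWF.HereditarilyFinite.singular⟩
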